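/- There is a universal constant $C_0>0$ (in particular independent of the dimension) with the following property. Let $n\ge 1$, let $D\subset\mathbb C^n$ be a domain, and let $p\in\partial D$ be a $\mathcal C^{1,1}$-smooth boundary point, i.e. near $p$ one has $D=\{s<0\}$ for a real-valued $\mathcal C^{1,1}$ function $s$ with non-vanishing gradient. Let $n_q$ denote the inner unit normal to $\partial D$ at a boundary point $q$ near $p$, and set $$\chi_{D,p}=\limsup_{\partial D\ni p',p''\to p,\ p'\ne p''}\frac{|n_{p'}-n_{p''}|}{|p'-p''|}.$$ Then $\chi_{D,p}<\infty$. Suppose that $\chi_{D,p}>0$. Then there is a neighborhood $U$ of $p$ such that every $z\in D\cap U$ has a unique nearest boundary point $\pi(z)$, the normal $n_{\pi(z)}$ exists, and $$k_D(z,w)\le\log\bigl(1+C_0A_{D,p}(z,w)\bigr),\qquad z,w\in D\cap U,$$ where $$A_{D,p}(z,w)=\frac{|(z-w)_z|+\chi_{D,p}|z-w|^2+|z-w|\sqrt{\chi_{D,p}\,\delta_D(z)}}{\sqrt{\delta_D(z)\,\delta_D(w)}},$$ $\delta_D(z)=\mathrm{dist}(z,\partial D)$, and $X_z=\langle X,n_{\pi(z)}\rangle$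 with the Hermitian inner product $\langle Z,W\rangle=\sum_j Z_j\overline{W_j}$. Here $k_D$ is the Kobayashi pseudodistance, i.e. the largest pseudodistance on $D$ not exceeding the Lempert function $$l_D(z,w)=\inf\{\tanh^{-1}|\alpha|:\ \exists\,\varphi\in\mathcal O(\mathbb D,D),\ \varphi(0)=z,\ \varphi(\alpha)=w\}.$$ -/

import Mathlib

open Set Filter Topology Metric
open scoped ENNReal NNReal

noncomputable section

/-! ## The Kobayashi pseudodistance -/

/-- The Lempert function `l_D(z,w) = inf {artanh |α| : φ ∈ 𝒪(𝔻, D), φ(0) = z, φ(α) = w}`,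
with values in `[0,∞]` (the infimum of the empty set is `∞`). -/
def lempert {n : ℕ} (D : Set (EuclideanSpace ℂ (Fin n)))
    (z w : EuclideanSpace ℂ (Fin n)) : ℝ≥0∞ :=
  ⨅ (φ : ℂ → EuclideanSpace ℂ (Fin n)) (α : ℂ)
    (_ : DifferentiableOn ℂ φ (ball 0 1) ∧ MapsTo φ (ball 0 1) D ∧
      α ∈ ball (0 : ℂ) 1 ∧ φ 0 = z ∧ φ α = w),
    ENNReal.ofReal (Real.artanh ‖α‖)

/-- `d` is a pseudodistance on the set `D`. -/
structure IsPseudodistOn {X : Type*} (D : Set X) (d : X → X → ℝ≥0∞) : Prop where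
  self : ∀ x ∈ D, d x x = 0
  symm : ∀ x ∈ D, ∀ y ∈ D, d x y = d y x
  triangle : ∀ x ∈ D, ∀ y ∈ D, ∀ z ∈ D, d x z ≤ d x y + d y z

/-- The Kobayashi pseudodistance: the largest pseudodistance on `D` not exceeding the Lempert
function, i.e. the supremum of all of them. -/
def kobayashi {n : ℕ} (D : Set (EuclideanSpace ℂ (Fin n)))
    (z w : EuclideanSpace ℂ (Fin n)) : ℝ≥0∞ :=
  ⨆ (d : EuclideanSpace ℂ (Fin n) → EuclideanSpace ℂ (Fin n) → ℝ≥0∞)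
    (_ : IsPseudodistOn D d ∧ ∀ x ∈ D, ∀ y ∈ D, d x y ≤ lempert D x y), d z w

/-- The supremum defining `kobayashi` is itself a pseudodistance ... -/
theorem kobayashi_isPseudodistOn {n : ℕ} (D : Set (EuclideanSpace ℂ (Fin n))) :
    IsPseudodistOn D (kobayashi D) where
  self x hx := by
    simp only [kobayashi, ENNReal.iSup_eq_zero]
    exact fun d hd => hd.1.self x hx
  symm x hx y hy := iSup_congr fun d => iSup_congr fun hd => hd.1.symm x hx y hy
  triangle x hx y hy z hz := iSup₂_le fun d hd =>
    (hd.1.triangle x hx y hy z hz).trans (add_le_add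
      (le_iSup₂ (f := fun d (_ : IsPseudodistOn D d ∧ ∀ x ∈ D, ∀ y ∈ D, d x y ≤ lempert D x y)
        => d x y) d hd)
      (le_iSup₂ (f := fun d (_ : IsPseudodistOn D d ∧ ∀ x ∈ D, ∀ y ∈ D, d x y ≤ lempert D x y)
        => d y z) d hd))

/-- ... and does not exceed the Lempert function, so it is the largest one. -/
theorem kobayashi_le_lempert {n : ℕ} (D : Set (EuclideanSpace ℂ (Fin n)))
    {z w : EuclideanSpace ℂ (Fin n)} (hz : z ∈ D) (hw : w ∈ D) :
    kobayashi D z w ≤ lempert D z w :=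
  iSup₂_le fun _ hd => hd.2 z hz w hw

/-! ## Smooth boundary points and the inner normal -/

/-- `s` is a `𝒞¹` defining function of `D` on the open set `V`. -/
structure IsC1DefiningOn {n : ℕ} (D V : Set (EuclideanSpace ℂ (Fin n)))
    (s : EuclideanSpace ℂ (Fin n) → ℝ) : Prop where
  isOpen : IsOpen V
  contDiffOn : ContDiffOn ℝ 1 s V
  gradient_ne_zero : ∀ x ∈ V, gradient s x ≠ 0
  mem_iff : ∀ x ∈ V, x ∈ D ↔ s x < 0

/-- `p` is a `𝒞^{1,1}`-smooth boundary point of `D`: near `p`, the set `D` is `{s < 0}` for some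
`s` of class `𝒞^{1,1}` (i.e. with Lipschitz gradient) whose gradient does not vanish. -/
def IsC11BoundaryPoint {n : ℕ} (D : Set (EuclideanSpace ℂ (Fin n)))
    (p : EuclideanSpace ℂ (Fin n)) : Prop :=
  p ∈ frontier D ∧ ∃ (V : Set (EuclideanSpace ℂ (Fin n))) (s : EuclideanSpace ℂ (Fin n) → ℝ),
    p ∈ V ∧ IsC1DefiningOn D V s ∧ ∃ K : ℝ≥0, LipschitzOnWith K (gradient s) V

/-- `ν` is the inner unit normal vector to `∂D` at the (`𝒞¹`-smooth) boundary point `q`. -/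
def IsInnerUnitNormal {n : ℕ} (D : Set (EuclideanSpace ℂ (Fin n)))
    (q ν : EuclideanSpace ℂ (Fin n)) : Prop :=
  q ∈ frontier D ∧ ∃ (V : Set (EuclideanSpace ℂ (Fin n))) (s : EuclideanSpace ℂ (Fin n) → ℝ),
    q ∈ V ∧ IsC1DefiningOn D V s ∧ ν = -((‖gradient s q‖⁻¹ : ℝ) • gradient s q)

/-- A defining function is positive, resp. negative, a little way along a direction which has
positive, resp. negative, inner product with its gradient. -/
theorem IsC1DefiningOn.eventually_mem_iff {n : ℕ} {D V : Set (EuclideanSpace ℂ (Fin n))}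
    {s : EuclideanSpace ℂ (Fin n) → ℝ} (hs : IsC1DefiningOn D V s)
    {q : EuclideanSpace ℂ (Fin n)} (hq : q ∈ V) (hqD : q ∈ frontier D)
    (v : EuclideanSpace ℂ (Fin n)) (hv : inner ℝ (gradient s q) v ≠ 0) :
    ∀ᶠ t : ℝ in 𝓝[>] 0, q + t • v ∈ D ↔ inner ℝ (gradient s q) v < 0 := by
  have hdiff : DifferentiableAt ℝ s q :=
    (hs.contDiffOn.contDiffAt (hs.isOpen.mem_nhds hq)).differentiableAt (by norm_num)
  have hcont : ContinuousAt s q := hdiff.continuousAt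
  have hs0 : s q = 0 := by
    rcases lt_trichotomy (s q) 0 with h | h | h
    · exfalso
      have h1 : ∀ᶠ x in 𝓝 q, x ∈ D := by
        filter_upwards [hcont.eventually_lt_const h, hs.isOpen.mem_nhds hq] with x hx hxV
        exact (hs.mem_iff x hxV).2 hx
      exact hqD.2 (mem_interior_iff_mem_nhds.2 h1)
    · exact h
    · exfalso
      have h1 : ∀ᶠ x in 𝓝 q, x ∉ D := by
        filter_upwards [hcont.eventually_const_lt h, hs.isOpen.mem_nhds hq] with x hx hxV
        exact fun hD => lt_asymm hx ((hs.mem_iff x hxV).1 hD)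
      obtain ⟨x, hx, hx'⟩ := (mem_closure_iff_frequently.1 hqD.1).and_eventually h1 |>.exists
      exact hx' hx
  have hline : HasDerivAt (fun t : ℝ => s (q + t • v)) (inner ℝ (gradient s q) v) 0 := by
    have h1 : HasDerivAt (fun t : ℝ => q + t • v) v 0 := by
      simpa using ((hasDerivAt_id (0 : ℝ)).smul_const v).const_add q
    have h2 : HasFDerivAt s (InnerProductSpace.toDual ℝ _ (gradient s q)) (q + (0 : ℝ) • v) := by
      simpa using hdiff.hasGradientAt.hasFDerivAt
    have h3 := h2.comp_hasDerivAt (0 : ℝ) h1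
    rwa [InnerProductSpace.toDual_apply_apply] at h3
  have hmem : ∀ᶠ t : ℝ in 𝓝[>] 0, q + t • v ∈ V := by
    have hc : ContinuousAt (fun t : ℝ => q + t • v) 0 := by fun_prop
    exact nhdsWithin_le_nhds (hc.eventually (by simpa using hs.isOpen.mem_nhds hq))
  have hslope := (hasDerivAt_iff_tendsto_slope.1 hline).mono_left
    (nhdsWithin_mono 0 (fun t (ht : 0 < t) => ht.ne' : Ioi (0 : ℝ) ⊆ {0}ᶜ))
  rcases lt_or_gt_of_ne hv with h | h
  · filter_upwards [hslope.eventually_lt_const h, hmem, self_mem_nhdsWithin] with t ht htV ht0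
    rw [hs.mem_iff _ htV]
    simp only [slope, vsub_eq_sub, sub_zero, zero_smul, add_zero, hs0, smul_eq_mul] at ht
    have ht0 : 0 < t := ht0
    have : s (q + t • v) < 0 := by
      by_contra hc
      exact absurd ht (not_lt.2 (mul_nonneg (inv_nonneg.2 ht0.le) (not_lt.1 hc)))
    exact ⟨fun _ => h, fun _ => this⟩
  · filter_upwards [hslope.eventually_const_lt h, hmem, self_mem_nhdsWithin] with t ht htV ht0
    rw [hs.mem_iff _ htV]
    simp only [slope, vsub_eq_sub, sub_zero, zero_smul, add_zero, hs0, smul_eq_mul] at ht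
    have ht0 : 0 < t := ht0
    have : 0 < s (q + t • v) := by
      by_contra hc
      exact absurd ht (not_lt.2 (mul_nonpos_of_nonneg_of_nonpos (inv_nonneg.2 ht0.le)
        (not_lt.1 hc)))
    exact ⟨fun h' => absurd h' this.le.not_gt, fun h' => absurd h' h.le.not_gt⟩

/-- The inner unit normal does not depend on the defining function. -/
theorem IsInnerUnitNormal.unique {n : ℕ} {D : Set (EuclideanSpace ℂ (Fin n))}
    {q ν μ : EuclideanSpace ℂ (Fin n)} (hν : IsInnerUnitNormal D q ν)
    (hμ : IsInnerUnitNormal D q μ) : ν = μ := by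
  obtain ⟨hq, V, s, hqV, hs, hνs⟩ := hν
  obtain ⟨-, W, r, hqW, hr, hμr⟩ := hμ
  by_contra hne
  have ha : 0 < ‖gradient s q‖ := norm_pos_iff.2 (hs.gradient_ne_zero q hqV)
  have hb : 0 < ‖gradient r q‖ := norm_pos_iff.2 (hr.gradient_ne_zero q hqW)
  have hgs : gradient s q = -(‖gradient s q‖ • ν) := by
    rw [hνs, smul_neg, smul_smul, mul_inv_cancel₀ ha.ne', one_smul, neg_neg]
  have hgr : gradient r q = -(‖gradient r q‖ • μ) := by
    rw [hμr, smul_neg, smul_smul, mul_inv_cancel₀ hb.ne', one_smul, neg_neg]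
  have hν1 : ‖ν‖ = 1 := by
    rw [hνs, norm_neg, norm_smul, norm_inv, norm_norm, inv_mul_cancel₀ ha.ne']
  have hμ1 : ‖μ‖ = 1 := by
    rw [hμr, norm_neg, norm_smul, norm_inv, norm_norm, inv_mul_cancel₀ hb.ne']
  have hlt : inner ℝ ν μ < 1 := (inner_lt_one_iff_real_of_norm_eq_one hν1 hμ1).2 hne
  have h1 : inner ℝ (gradient s q) (ν - μ) < 0 := by
    rw [hgs, inner_neg_left, real_inner_smul_left, inner_sub_right,
      real_inner_self_eq_norm_sq, hν1]
    have := mul_pos ha (sub_pos.2 hlt)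
    linarith
  have h2 : 0 < inner ℝ (gradient r q) (ν - μ) := by
    rw [hgr, inner_neg_left, real_inner_smul_left, inner_sub_right,
      real_inner_self_eq_norm_sq, hμ1, real_inner_comm]
    have := mul_pos hb (sub_pos.2 hlt)
    linarith
  obtain ⟨t, ht, ht'⟩ := ((hs.eventually_mem_iff hqV hq (ν - μ) h1.ne).and
    (hr.eventually_mem_iff hqW hq (ν - μ) h2.ne')).exists
  exact lt_asymm h2 (ht'.1 (ht.2 h1))

open Classical in
/-- The inner unit normal `n_q` to `∂D` at `q` (zero if there is none). -/
def innerNormal {n : ℕ} (D : Set (EuclideanSpace ℂ (Fin n)))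
    (q : EuclideanSpace ℂ (Fin n)) : EuclideanSpace ℂ (Fin n) :=
  if h : ∃ ν, IsInnerUnitNormal D q ν then h.choose else 0

/-- The curvature constant
`χ_{D,p} = limsup_{∂D ∋ p', p'' → p} |n_{p'} - n_{p''}| / |p' - p''|`, in `[0,∞]`. -/
def curvatureConst {n : ℕ} (D : Set (EuclideanSpace ℂ (Fin n)))
    (p : EuclideanSpace ℂ (Fin n)) : ℝ≥0∞ :=
  limsup (fun x : EuclideanSpace ℂ (Fin n) × EuclideanSpace ℂ (Fin n) =>
      ENNReal.ofReal (‖innerNormal D x.1 - innerNormal D x.2‖ / ‖x.1 - x.2‖))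
    (𝓝[(frontier D).offDiag] (p, p))

/-! ## Boundary distance, nearest point and the quantity `A_{D,p}` -/

/-- `δ_D(z) = dist(z, ∂D)`. -/
def bdist {n : ℕ} (D : Set (EuclideanSpace ℂ (Fin n)))
    (z : EuclideanSpace ℂ (Fin n)) : ℝ :=
  infDist z (frontier D)

/-- `q` is the unique boundary point nearest to `z`. -/
def IsProj {n : ℕ} (D : Set (EuclideanSpace ℂ (Fin n)))
    (z q : EuclideanSpace ℂ (Fin n)) : Prop :=
  ∀ q', (q' ∈ frontier D ∧ dist z q' = bdist D z) ↔ q' = q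

open Classical in
/-- The unique nearest boundary point `π(z)`, if it exists (zero otherwise). -/
def bproj {n : ℕ} (D : Set (EuclideanSpace ℂ (Fin n)))
    (z : EuclideanSpace ℂ (Fin n)) : EuclideanSpace ℂ (Fin n) :=
  if h : ∃ q, IsProj D z q then h.choose else 0

/-- `X_z = ⟨X, n_{π(z)}⟩ = ∑ⱼ Xⱼ conj (n_{π(z)})ⱼ` (Mathlib's inner product is conjugate-linear in
its first argument). -/
def normalComp {n : ℕ} (D : Set (EuclideanSpace ℂ (Fin n)))
    (z X : EuclideanSpace ℂ (Fin n)) : ℂ :=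
  inner ℂ (innerNormal D (bproj D z)) X

/-- `A_{D,p}(z,w)`, the curvature constant `χ = χ_{D,p}` (finite at `𝒞^{1,1}` points) being
inserted. -/
def AQuantity {n : ℕ} (D : Set (EuclideanSpace ℂ (Fin n)))
    (p z w : EuclideanSpace ℂ (Fin n)) : ℝ :=
  (‖normalComp D z (z - w)‖ + (curvatureConst D p).toReal * ‖z - w‖ ^ 2
      + ‖z - w‖ * √((curvatureConst D p).toReal * bdist D z))
    / √(bdist D z * bdist D w)

end

/-! ## Inner normals -/

section InnerNormal

variable {n : ℕ} {D V : Set (EuclideanSpace ℂ (Fin n))} {s : EuclideanSpace ℂ (Fin n) → ℝ}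
  {q ν : EuclideanSpace ℂ (Fin n)}

/-! An upper bound for the Kobayashi distance only needs analytic discs inside `D` and the triangle
inequality; affine discs suffice.

Geometry: any constant above `χ` is a Lipschitz constant `L` of the normals near `p`. Following the
defining function along segments from a boundary point `q` turns this into a paraboloid condition:
`L|x - q|² < Re⟨x - q, n_q⟩` forces `x ∈ D`. With `L = 2χ`, smallness conditions on `χ` and on the
size of the neighborhood go into `U`, so the constant in the estimate is universal. Points near `p`
are written `z = q + δ n_q`, `w = q' + δ' n_{q'}`. An affine disc at height `h` over `q` fits into
`D` if its radius is at most about `h` in the complex normal direction and about `√(h/χ)` in all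
directions (`HasLipschitzNormals.disc`).

Let `X = z - w`, `d = |X|`, `N = |⟨X, n_q⟩|`. If `N + χd²` is small against `δ`
(`kobayashi_le_of_near`), one disc centred at `z` reaches `w` at a parameter of size `N/δ +
d√(χ/δ)`, which is bounded by a multiple of `A`. Otherwise (`kobayashi_le_of_far`), both points
climb along their normals to a height `H` comparable to `N + χd²`, where a single disc joins them.
The climbs cost `log √(2H/δ)` and `log √(2H/δ')`, the crossing `log 2`; the sum is `log
(4H/√(δδ'))`. The bound for `|δ - δ'|` in `abs_sub_le` makes the two heights comparable where
needed. -/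

theorem real_inner_eq_re_complex_inner (x y : EuclideanSpace ℂ (Fin n)) :
    inner ℝ x y = (inner ℂ x y).re := by
  simp [PiLp.inner_apply, Complex.inner, mul_comm]

theorem IsInnerUnitNormal.innerNormal_eq (h : IsInnerUnitNormal D q ν) : innerNormal D q = ν := by
  have hex : ∃ ν, IsInnerUnitNormal D q ν := ⟨ν, h⟩
  rw [innerNormal, dif_pos hex]
  exact hex.choose_spec.unique h

theorem IsInnerUnitNormal.norm_eq_one (h : IsInnerUnitNormal D q ν) : ‖ν‖ = 1 := by
  obtain ⟨-, V, s, hqV, hs, rfl⟩ := h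
  have ha : 0 < ‖gradient s q‖ := norm_pos_iff.2 (hs.gradient_ne_zero q hqV)
  rw [norm_neg, norm_smul, norm_inv, norm_norm, inv_mul_cancel₀ ha.ne']

theorem IsInnerUnitNormal.eventually_mem_iff (h : IsInnerUnitNormal D q ν)
    {v : EuclideanSpace ℂ (Fin n)} (hv : inner ℝ ν v ≠ 0) :
    ∀ᶠ t : ℝ in 𝓝[>] 0, q + t • v ∈ D ↔ 0 < inner ℝ ν v := by
  obtain ⟨hq, V, s, hqV, hs, rfl⟩ := h
  have ha : 0 < ‖gradient s q‖⁻¹ := inv_pos.2 (norm_pos_iff.2 (hs.gradient_ne_zero q hqV))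
  rw [inner_neg_left, real_inner_smul_left] at hv ⊢
  have hv' : inner ℝ (gradient s q) v ≠ 0 := by
    rintro h0
    simp [h0] at hv
  filter_upwards [hs.eventually_mem_iff hqV hq v hv'] with t ht
  rw [ht, neg_pos, mul_neg_iff]
  constructor
  · exact fun h => Or.inl ⟨ha, h⟩
  · rintro (⟨-, h⟩ | ⟨h, -⟩)
    · exact h
    · exact absurd h ha.le.not_gt

theorem IsC1DefiningOn.differentiableAt (hs : IsC1DefiningOn D V s) (hq : q ∈ V) :
    DifferentiableAt ℝ s q :=
  (hs.contDiffOn.contDiffAt (hs.isOpen.mem_nhds hq)).differentiableAt (by norm_num)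

theorem IsC1DefiningOn.hasDerivAt_line (hs : IsC1DefiningOn D V s)
    (v : EuclideanSpace ℂ (Fin n)) {t : ℝ} (ht : q + t • v ∈ V) :
    HasDerivAt (fun t : ℝ => s (q + t • v)) (inner ℝ (gradient s (q + t • v)) v) t := by
  have h1 : HasDerivAt (fun t : ℝ => q + t • v) v t := by
    simpa using ((hasDerivAt_id t).smul_const v).const_add q
  have h3 := (hs.differentiableAt ht).hasGradientAt.hasFDerivAt.comp_hasDerivAt t h1
  rwa [InnerProductSpace.toDual_apply_apply] at h3

theorem IsC1DefiningOn.eq_zero_of_mem_frontier (hs : IsC1DefiningOn D V s) (hq : q ∈ V)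
    (hqD : q ∈ frontier D) : s q = 0 := by
  have hcont : ContinuousAt s q := (hs.differentiableAt hq).continuousAt
  rcases lt_trichotomy (s q) 0 with h | h | h
  · exfalso
    refine hqD.2 (mem_interior_iff_mem_nhds.2 ?_)
    filter_upwards [hcont.eventually_lt_const h, hs.isOpen.mem_nhds hq] with x hx hxV
    exact (hs.mem_iff x hxV).2 hx
  · exact h
  · exfalso
    have h1 : ∀ᶠ x in 𝓝 q, x ∉ D := by
      filter_upwards [hcont.eventually_const_lt h, hs.isOpen.mem_nhds hq] with x hx hxV
      exact fun hD => lt_asymm hx ((hs.mem_iff x hxV).1 hD)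
    obtain ⟨x, hx, hx'⟩ := (mem_closure_iff_frequently.1 hqD.1).and_eventually h1 |>.exists
    exact hx' hx

theorem eventually_lt_right_of_hasDerivAt_neg {f : ℝ → ℝ} {a f' : ℝ} (hf : HasDerivAt f f' a)
    (h : f' < 0) : ∀ᶠ t in 𝓝[>] a, f t < f a := by
  have hslope := (hasDerivAt_iff_tendsto_slope.1 hf).mono_left
    (nhdsWithin_mono a (fun t (ht : a < t) => ht.ne' : Ioi a ⊆ {a}ᶜ))
  filter_upwards [hslope.eventually_lt_const h, self_mem_nhdsWithin] with t ht hta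
  have hta : 0 < t - a := sub_pos.2 hta
  rw [slope_def_field, div_lt_iff₀ hta] at ht
  linarith

theorem eventually_lt_left_of_hasDerivAt_neg {f : ℝ → ℝ} {a f' : ℝ} (hf : HasDerivAt f f' a)
    (h : f' < 0) : ∀ᶠ t in 𝓝[<] a, f a < f t := by
  have hslope := (hasDerivAt_iff_tendsto_slope.1 hf).mono_left
    (nhdsWithin_mono a (fun t (ht : t < a) => ht.ne : Iio a ⊆ {a}ᶜ))
  filter_upwards [hslope.eventually_lt_const h, self_mem_nhdsWithin] with t ht hta
  have hta : t - a < 0 := sub_neg.2 hta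
  rw [slope_def_field, div_lt_iff_of_neg hta] at ht
  linarith

/-- A function whose derivative is negative at all of its zeros does not come back to zero. -/
theorem neg_of_deriv_neg_of_eq_zero {f f' : ℝ → ℝ} (hf : ∀ t ∈ Icc (0 : ℝ) 1, HasDerivAt f (f' t) t)
    (h0 : f 0 = 0) (hneg : ∀ t ∈ Icc (0 : ℝ) 1, f t = 0 → f' t < 0) : f 1 < 0 := by
  have hle : ∀ t ∈ Icc (0 : ℝ) 1, f t ≤ 0 := fun t ht =>
    image_le_of_deriv_right_lt_deriv_boundary (B := fun _ => 0) (B' := fun _ => 0)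
      (fun t ht => (hf t ht).continuousAt.continuousWithinAt)
      (fun t ht => (hf t ⟨ht.1, ht.2.le⟩).hasDerivWithinAt) h0.le
      (fun t => hasDerivAt_const t 0) (fun t ht h => hneg t ⟨ht.1, ht.2.le⟩ h) ht
  -- A zero at the endpoint, with negative derivative, would make `f` positive just to its left.
  refine lt_of_le_of_ne (hle 1 (by simp)) fun h1 => ?_
  have hm : (1 : ℝ) ∈ Icc (0 : ℝ) 1 := by simp
  obtain ⟨t, ht, ht'⟩ := ((eventually_lt_left_of_hasDerivAt_neg (hf 1 hm) (hneg 1 hm h1)).and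
    (Ico_mem_nhdsLT (zero_lt_one' ℝ))).exists
  exact absurd (hle t ⟨ht'.1, ht'.2.le⟩) (by rw [h1] at ht; exact not_le.2 ht)

/-- Moving against the gradient makes `s` negative at once, so `q` is a limit of points of `D`. This
guarantees that every zero of `s` met along a segment carries a normal to which the Lipschitz bound
applies. -/
theorem IsC1DefiningOn.mem_frontier_of_eq_zero (hs : IsC1DefiningOn D V s) (hq : q ∈ V)
    (h0 : s q = 0) : q ∈ frontier D := by
  refine ⟨?_, fun h => lt_irrefl _ (h0 ▸ (hs.mem_iff q hq).1 (interior_subset h))⟩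
  have hd : HasDerivAt (fun t : ℝ => s (q + t • -gradient s q))
      (inner ℝ (gradient s (q + (0 : ℝ) • -gradient s q)) (-gradient s q)) 0 :=
    hs.hasDerivAt_line _ (by simpa using hq)
  have hneg : inner ℝ (gradient s (q + (0 : ℝ) • -gradient s q)) (-gradient s q) < 0 := by
    rw [zero_smul, add_zero, inner_neg_right, real_inner_self_eq_norm_sq, neg_lt_zero]
    exact pow_pos (norm_pos_iff.2 (hs.gradient_ne_zero q hq)) 2
  have hc : Tendsto (fun t : ℝ => q + t • -gradient s q) (𝓝[>] 0) (𝓝 q) := by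
    have : ContinuousAt (fun t : ℝ => q + t • -gradient s q) 0 := by fun_prop
    simpa [ContinuousAt] using this.mono_left nhdsWithin_le_nhds
  refine mem_closure_of_tendsto hc ?_
  filter_upwards [eventually_lt_right_of_hasDerivAt_neg hd hneg,
    hc.eventually (hs.isOpen.mem_nhds hq)] with t ht htV
  refine (hs.mem_iff _ htV).2 ?_
  simpa [h0] using ht

theorem IsC1DefiningOn.isInnerUnitNormal (hs : IsC1DefiningOn D V s) (hq : q ∈ V)
    (hqD : q ∈ frontier D) :
    IsInnerUnitNormal D q (-((‖gradient s q‖⁻¹ : ℝ) • gradient s q)) :=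
  ⟨hqD, V, s, hq, hs, rfl⟩

theorem IsC1DefiningOn.isInnerUnitNormal_innerNormal (hs : IsC1DefiningOn D V s) (hq : q ∈ V)
    (hqD : q ∈ frontier D) : IsInnerUnitNormal D q (innerNormal D q) := by
  have h := hs.isInnerUnitNormal hq hqD
  rwa [h.innerNormal_eq]

theorem IsC1DefiningOn.gradient_eq (hs : IsC1DefiningOn D V s) (hq : q ∈ V)
    (hqD : q ∈ frontier D) : gradient s q = -(‖gradient s q‖ • innerNormal D q) := by
  have ha : 0 < ‖gradient s q‖ := norm_pos_iff.2 (hs.gradient_ne_zero q hq)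
  rw [(hs.isInnerUnitNormal hq hqD).innerNormal_eq, smul_neg, smul_smul, mul_inv_cancel₀ ha.ne',
    one_smul, neg_neg]

theorem norm_normalize_sub_normalize_le {E : Type*} [NormedAddCommGroup E] [NormedSpace ℝ E]
    {a b : E} (ha : a ≠ 0) (hb : b ≠ 0) :
    ‖‖a‖⁻¹ • a - ‖b‖⁻¹ • b‖ ≤ 2 * ‖a - b‖ / ‖a‖ := by
  have ha' : 0 < ‖a‖ := norm_pos_iff.2 ha
  have hb' : 0 < ‖b‖ := norm_pos_iff.2 hb
  have h : ‖a‖⁻¹ • a - ‖b‖⁻¹ • b = ‖a‖⁻¹ • ((a - b) + (‖b‖ - ‖a‖) • ‖b‖⁻¹ • b) := by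
    match_scalars
    · simp
    · field_simp
      ring
  rw [h, norm_smul, norm_inv, norm_norm, inv_mul_eq_div]
  gcongr
  refine (norm_add_le _ _).trans ?_
  rw [norm_smul, norm_smul, norm_inv, norm_norm, inv_mul_cancel₀ hb'.ne', mul_one, two_mul]
  gcongr
  rw [Real.norm_eq_abs, abs_sub_comm]
  exact abs_norm_sub_norm_le a b

end InnerNormal

/-! ## The local geometry of a `𝒞^{1,1}` boundary -/

/-- On the ball of radius `r` about `p`, the boundary of `D` has inner unit normals which are
Lipschitz with constant `L`, and it lies between the corresponding paraboloids. -/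
structure HasLipschitzNormals {n : ℕ} (D : Set (EuclideanSpace ℂ (Fin n)))
    (p : EuclideanSpace ℂ (Fin n)) (L r : ℝ) : Prop where
  radius_pos : 0 < r
  normal : ∀ q ∈ frontier D, q ∈ ball p r → IsInnerUnitNormal D q (innerNormal D q)
  lipschitz : ∀ q ∈ frontier D, q ∈ ball p r → ∀ q' ∈ frontier D, q' ∈ ball p r →
    ‖innerNormal D q - innerNormal D q'‖ ≤ L * ‖q - q'‖
  mem : ∀ q ∈ frontier D, q ∈ ball p r → ∀ x ∈ ball p r,
    L * ‖x - q‖ ^ 2 < inner ℝ (innerNormal D q) (x - q) → x ∈ D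
  abs_inner_le : ∀ q ∈ frontier D, q ∈ ball p r → ∀ q' ∈ frontier D, q' ∈ ball p r →
    |inner ℝ (innerNormal D q) (q' - q)| ≤ L * ‖q' - q‖ ^ 2

section LocalGeometry

variable {n : ℕ} {D V : Set (EuclideanSpace ℂ (Fin n))} {s : EuclideanSpace ℂ (Fin n) → ℝ}
  {p : EuclideanSpace ℂ (Fin n)}

/-- A segment leaving a boundary point `q` at an angle which is large compared with the variation
of the normals stays on the side of `D` on which it starts. -/
theorem IsC1DefiningOn.segment_side (hs : IsC1DefiningOn D V s) {r L : ℝ} (hL0 : 0 ≤ L) (hr : ball p r ⊆ V)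
    (hL : ∀ q ∈ frontier D, q ∈ ball p r → ∀ q' ∈ frontier D, q' ∈ ball p r →
      ‖innerNormal D q - innerNormal D q'‖ ≤ L * ‖q - q'‖)
    {q x : EuclideanSpace ℂ (Fin n)} (hq : q ∈ frontier D) (hqr : q ∈ ball p r)
    (hx : x ∈ ball p r) :
    (L * ‖x - q‖ ^ 2 < inner ℝ (innerNormal D q) (x - q) → s x < 0) ∧
      (inner ℝ (innerNormal D q) (x - q) < -(L * ‖x - q‖ ^ 2) → 0 < s x) := by
  set v := x - q with hv
  have hmem : ∀ t ∈ Icc (0 : ℝ) 1, q + t • v ∈ ball p r := fun t ht =>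
    (convex_ball p r).add_smul_sub_mem hqr hx ht
  have hderiv : ∀ t ∈ Icc (0 : ℝ) 1, HasDerivAt (fun t : ℝ => s (q + t • v))
      (inner ℝ (gradient s (q + t • v)) v) t := fun t ht => hs.hasDerivAt_line v (hr (hmem t ht))
  have hs0 : s q = 0 := hs.eq_zero_of_mem_frontier (hr hqr) hq
  -- The Lipschitz bound is only known at boundary points, hence only at zeros of `s`. There it
  -- fixes the sign of the derivative along `v`, which is all that `neg_of_deriv_neg_of_eq_zero`
  -- requires.
  have key : ∀ t ∈ Icc (0 : ℝ) 1, s (q + t • v) = 0 →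
      0 < ‖gradient s (q + t • v)‖ ∧ q + t • v ∈ frontier D ∧
      |inner ℝ (innerNormal D q) v - inner ℝ (innerNormal D (q + t • v)) v| ≤ L * ‖v‖ ^ 2 := by
    intro t ht h0
    have hf := hs.mem_frontier_of_eq_zero (hr (hmem t ht)) h0
    refine ⟨norm_pos_iff.2 (hs.gradient_ne_zero _ (hr (hmem t ht))), hf, ?_⟩
    rw [← inner_sub_left]
    refine (abs_real_inner_le_norm _ _).trans ?_
    have h1 := hL q hq hqr _ hf (hmem t ht)
    have h2 : ‖q - (q + t • v)‖ = t * ‖v‖ := by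
      rw [sub_add_cancel_left, norm_neg, norm_smul, Real.norm_of_nonneg ht.1]
    rw [h2] at h1
    have h4 : t * ‖v‖ ≤ ‖v‖ := mul_le_of_le_one_left (norm_nonneg v) ht.2
    calc _ ≤ (L * (t * ‖v‖)) * ‖v‖ := by gcongr
      _ ≤ (L * ‖v‖) * ‖v‖ := by gcongr
      _ = _ := by ring
  have hend : q + (1 : ℝ) • v = x := by rw [one_smul, hv, add_sub_cancel]
  constructor
  · intro h
    have := neg_of_deriv_neg_of_eq_zero hderiv (by simpa using hs0) fun t ht h0 => by
      obtain ⟨hpos, hf, hle⟩ := key t ht h0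
      rw [hs.gradient_eq (hr (hmem t ht)) hf, inner_neg_left, real_inner_smul_left, neg_lt_zero]
      have := (abs_le.1 hle).2
      exact mul_pos hpos (by linarith)
    rwa [hend] at this
  · intro h
    have := neg_of_deriv_neg_of_eq_zero (fun t ht => (hderiv t ht).neg) (by simpa using hs0)
      fun t ht h0 => by
        obtain ⟨hpos, hf, hle⟩ := key t ht (by simpa using h0)
        rw [hs.gradient_eq (hr (hmem t ht)) hf, inner_neg_left, real_inner_smul_left, neg_neg]
        have := (abs_le.1 hle).1
        exact mul_neg_of_pos_of_neg hpos (by linarith)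
    have h1 : -s (q + (1 : ℝ) • v) < 0 := this
    rwa [hend, neg_lt_zero] at h1

/-- Near a `𝒞^{1,1}` boundary point the inner unit normals are Lipschitz. -/
theorem IsC11BoundaryPoint.exists_lipschitz_normal (hp : IsC11BoundaryPoint D p) :
    ∃ K r : ℝ, 0 < r ∧ ∀ q ∈ frontier D, q ∈ ball p r → ∀ q' ∈ frontier D, q' ∈ ball p r →
      ‖innerNormal D q - innerNormal D q'‖ ≤ K * ‖q - q'‖ := by
  obtain ⟨-, V, s, hpV, hs, K, hK⟩ := hp
  have hgp : 0 < ‖gradient s p‖ := norm_pos_iff.2 (hs.gradient_ne_zero p hpV)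
  have hcont : ContinuousAt (gradient s) p := hK.continuousOn.continuousAt (hs.isOpen.mem_nhds hpV)
  obtain ⟨r, hr, hball⟩ := Metric.mem_nhds_iff.1 (inter_mem (hs.isOpen.mem_nhds hpV)
    (hcont.norm.eventually_const_lt (half_lt_self hgp)))
  -- On the ball `|∇s| > |∇s(p)| / 2`, and normalizing costs a factor `2 / |∇s|`.
  refine ⟨2 * K / (‖gradient s p‖ / 2), r, hr, fun q hq hqr q' hq' hqr' => ?_⟩
  have hqV := (hball hqr).1
  have hqV' := (hball hqr').1
  rw [(hs.isInnerUnitNormal hqV hq).innerNormal_eq, (hs.isInnerUnitNormal hqV' hq').innerNormal_eq,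
    neg_sub_neg, norm_sub_rev]
  have hd : ‖gradient s q - gradient s q'‖ ≤ K * ‖q - q'‖ := by
    simpa [dist_eq_norm] using hK.dist_le_mul q hqV q' hqV'
  calc _ ≤ 2 * ‖gradient s q - gradient s q'‖ / ‖gradient s q‖ :=
        norm_normalize_sub_normalize_le (hs.gradient_ne_zero q hqV) (hs.gradient_ne_zero q' hqV')
    _ ≤ 2 * (K * ‖q - q'‖) / (‖gradient s p‖ / 2) := by
        gcongr
        exact (hball hqr).2.le
    _ = _ := by ring

theorem IsC11BoundaryPoint.curvatureConst_lt_top (hp : IsC11BoundaryPoint D p) :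
    curvatureConst D p < ⊤ := by
  obtain ⟨K, r, hr, hK⟩ := hp.exists_lipschitz_normal
  refine lt_of_le_of_lt (limsup_le_of_le (by isBoundedDefault) ?_) (ENNReal.ofReal_lt_top (r := K))
  have hb : ball p r ×ˢ ball p r ∈ 𝓝[(frontier D).offDiag] (p, p) :=
    nhdsWithin_le_nhds (prod_mem_nhds (ball_mem_nhds p hr) (ball_mem_nhds p hr))
  filter_upwards [hb, self_mem_nhdsWithin] with x hx hxD
  have hne : 0 < ‖x.1 - x.2‖ := norm_pos_iff.2 (sub_ne_zero.2 hxD.2.2)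
  refine ENNReal.ofReal_le_ofReal ((div_le_iff₀ hne).2 ?_)
  exact hK _ hxD.1 hx.1 _ hxD.2.1 hx.2

/-- Any constant larger than `χ_{D,p}` is a Lipschitz constant of the normals near `p`. -/
theorem exists_lipschitz_of_curvatureConst_lt {L : ℝ}
    (hL : curvatureConst D p < ENNReal.ofReal L) :
    ∃ r : ℝ, 0 < r ∧ ∀ q ∈ frontier D, q ∈ ball p r → ∀ q' ∈ frontier D, q' ∈ ball p r →
      ‖innerNormal D q - innerNormal D q'‖ ≤ L * ‖q - q'‖ := by
  have h := eventually_nhdsWithin_iff.1 (eventually_lt_of_limsup_lt hL)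
  obtain ⟨r, hr, hball⟩ := Metric.eventually_nhds_iff_ball.1 h
  refine ⟨r, hr, fun q hq hqr q' hq' hqr' => ?_⟩
  rcases eq_or_ne q q' with rfl | hne
  · simp
  have hmem : (q, q') ∈ ball (p, p) r := by
    rw [← ball_prod_same]
    exact ⟨hqr, hqr'⟩
  have h1 := (ENNReal.ofReal_lt_ofReal_iff'.1 (hball _ hmem ⟨hq, hq', hne⟩)).1.le
  exact (div_le_iff₀ (norm_pos_iff.2 (sub_ne_zero.2 hne))).1 h1

theorem IsC11BoundaryPoint.exists_hasLipschitzNormals (hp : IsC11BoundaryPoint D p) {L : ℝ}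
    (hL0 : 0 ≤ L) (hL : curvatureConst D p < ENNReal.ofReal L) :
    ∃ r, HasLipschitzNormals D p L r := by
  obtain ⟨r₁, hr₁, hlip⟩ := exists_lipschitz_of_curvatureConst_lt hL
  obtain ⟨-, V, s, hpV, hs, -⟩ := hp
  obtain ⟨r₂, hr₂, hV⟩ := Metric.mem_nhds_iff.1 (hs.isOpen.mem_nhds hpV)
  have hV' : ball p (min r₁ r₂) ⊆ V := (ball_subset_ball (min_le_right _ _)).trans hV
  have hsub : ball p (min r₁ r₂) ⊆ ball p r₁ := ball_subset_ball (min_le_left _ _)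
  have hlip' : ∀ q ∈ frontier D, q ∈ ball p (min r₁ r₂) → ∀ q' ∈ frontier D,
      q' ∈ ball p (min r₁ r₂) → ‖innerNormal D q - innerNormal D q'‖ ≤ L * ‖q - q'‖ :=
    fun q hq hqr q' hq' hqr' => hlip q hq (hsub hqr) q' hq' (hsub hqr')
  refine ⟨min r₁ r₂, lt_min hr₁ hr₂,
    fun q hq hqr => hs.isInnerUnitNormal_innerNormal (hV' hqr) hq, hlip', ?_, ?_⟩
  · exact fun q hq hqr x hx h =>
      (hs.mem_iff x (hV' hx)).2 ((hs.segment_side hL0 hV' hlip' hq hqr hx).1 h)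
  · intro q hq hqr q' hq' hqr'
    have h0 := hs.eq_zero_of_mem_frontier (hV' hqr') hq'
    have h := hs.segment_side hL0 hV' hlip' hq hqr hqr'
    rw [h0] at h
    -- At a boundary point `s` vanishes, so both strict alternatives of `segment_side` fail.
    exact abs_le.2 ⟨not_lt.1 fun h' => lt_irrefl _ (h.2 h'),
      not_lt.1 fun h' => lt_irrefl _ (h.1 h')⟩

end LocalGeometry

/-! ## The nearest boundary point -/

section NearestPoint

variable {n : ℕ} {D : Set (EuclideanSpace ℂ (Fin n))} {p z q q' ν : EuclideanSpace ℂ (Fin n)}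

theorem IsProj.bproj_eq (h : IsProj D z q) : bproj D z = q := by
  have hex : ∃ q, IsProj D z q := ⟨q, h⟩
  rw [bproj, dif_pos hex]
  exact (h _).1 ((hex.choose_spec _).2 rfl)

theorem bdist_le_dist (hp : p ∈ frontier D) : bdist D z ≤ dist z p := infDist_le_dist_of_mem hp

theorem bdist_pos (hD : IsOpen D) (hz : z ∈ D) (hp : p ∈ frontier D) : 0 < bdist D z :=
  (isClosed_frontier.notMem_iff_infDist_pos ⟨p, hp⟩).1 fun h => h.2 (hD.interior_eq.symm ▸ hz)

/-- The ball is connected, meets `D` at its centre and misses `∂D`, so it cannot leave `D`. -/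
theorem ball_bdist_subset (hD : IsOpen D) (hz : z ∈ D) (hp : p ∈ frontier D) :
    ball z (bdist D z) ⊆ D := by
  refine (convex_ball z (bdist D z)).isPreconnected.subset_left_of_subset_union hD
    (isClosed_closure (s := D)).isOpen_compl
    (disjoint_compl_right.mono_left subset_closure |>.mono_right le_rfl) ?_
    ⟨z, mem_ball_self (bdist_pos hD hz hp), hz⟩
  intro x hx
  by_contra h
  rw [mem_union, not_or, notMem_compl_iff] at h
  have hxf : x ∈ frontier D := ⟨h.2, by rw [hD.interior_eq]; exact h.1⟩
  have := bdist_le_dist (z := z) hxf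
  rw [mem_ball, dist_comm] at hx
  exact absurd hx this.not_gt

/-- The vector from a nearest boundary point is normal to the boundary. -/
theorem IsInnerUnitNormal.eq_add_bdist_smul (hν : IsInnerUnitNormal D q ν) (hD : IsOpen D)
    (hz : z ∈ D) (hq : dist z q = bdist D z) : z = q + bdist D z • ν := by
  have hδ := bdist_pos hD hz hν.1
  set δ := bdist D z with hδ_def
  have hzq : ‖z - q‖ = δ := by rw [← dist_eq_norm, hq]
  set e := δ⁻¹ • (z - q) with he
  have he1 : ‖e‖ = 1 := by
    rw [he, norm_smul, hzq, norm_inv, Real.norm_of_nonneg hδ.le, inv_mul_cancel₀ hδ.ne']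
  have hze : z - q = δ • e := by rw [he, smul_smul, mul_inv_cancel₀ hδ.ne', one_smul]
  suffices h : e = ν by rw [← h, ← hze, add_sub_cancel]
  -- If `e ≠ ν`, the direction `e - ν` points out of `D` to first order at `q`, yet into the ball of
  -- radius `δ` about `z`, which lies in `D`.
  by_contra hne
  have hlt : inner ℝ ν e < 1 :=
    (inner_lt_one_iff_real_of_norm_eq_one hν.norm_eq_one he1).2 (Ne.symm hne)
  have h1 : inner ℝ ν (e - ν) < 0 := by
    rw [inner_sub_right, real_inner_self_eq_norm_sq, hν.norm_eq_one]
    linarith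
  have h2 : 0 < inner ℝ e (e - ν) := by
    rw [inner_sub_right, real_inner_self_eq_norm_sq, he1, real_inner_comm]
    linarith
  have hsmall : ∀ᶠ t : ℝ in 𝓝[>] 0, t * ‖e - ν‖ ^ 2 < 2 * δ * inner ℝ e (e - ν) := by
    have hc : ContinuousAt (fun t : ℝ => t * ‖e - ν‖ ^ 2) 0 := by fun_prop
    refine nhdsWithin_le_nhds (hc.eventually_lt_const ?_)
    simp only [zero_mul]
    positivity
  obtain ⟨t, ⟨ht, hts⟩, ht0⟩ := (((hν.eventually_mem_iff h1.ne).and hsmall).and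
    self_mem_nhdsWithin).exists
  have ht0 : 0 < t := ht0
  refine absurd (ht.1 (ball_bdist_subset hD hz hν.1 ?_)) h1.not_gt
  rw [mem_ball, dist_eq_norm, ← hδ_def]
  refine lt_of_pow_lt_pow_left₀ 2 hδ.le ?_
  have h3 : q + t • (e - ν) - z = t • (e - ν) - δ • e := by rw [← hze]; abel
  rw [h3, norm_sub_sq_real, norm_smul, norm_smul, he1, real_inner_smul_left, real_inner_smul_right,
    real_inner_comm, Real.norm_of_nonneg hδ.le, Real.norm_of_nonneg ht0.le]
  nlinarith [mul_lt_mul_of_pos_left hts ht0]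

theorem exists_dist_eq_bdist (hp : p ∈ frontier D) (z : EuclideanSpace ℂ (Fin n)) :
    ∃ q ∈ frontier D, dist z q = bdist D z := by
  obtain ⟨q, hq, h⟩ := isClosed_frontier.exists_infDist_eq_dist ⟨p, hp⟩ z
  exact ⟨q, hq, h.symm⟩

theorem dist_lt_of_dist_eq_bdist {ρ : ℝ} (hp : p ∈ frontier D) (hz : z ∈ ball p ρ)
    (hq : dist z q = bdist D z) : q ∈ ball p (2 * ρ) := by
  rw [mem_ball] at hz ⊢
  have := bdist_le_dist (z := z) hp
  have := dist_triangle_left q p z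
  linarith

/-- Near `p`, every point of `D` has a unique nearest boundary point. -/
theorem HasLipschitzNormals.isProj {L r ρ : ℝ} (G : HasLipschitzNormals D p L r)
    (hD : IsOpen D) (hp : p ∈ frontier D) (hρr : 2 * ρ ≤ r) (hL : 0 ≤ L) (hρL : L * ρ < 1)
    (hz : z ∈ D) (hzρ : z ∈ ball p ρ) (hq : q ∈ frontier D) (hzq : dist z q = bdist D z) :
    IsProj D z q := by
  have hmem : ∀ q, dist z q = bdist D z → q ∈ ball p r := fun q hq =>
    ball_subset_ball hρr (dist_lt_of_dist_eq_bdist hp hzρ hq)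
  refine fun q' => ⟨fun ⟨hq', hzq'⟩ => ?_, fun h => h ▸ ⟨hq, hzq⟩⟩
  have h1 := (G.normal q hq (hmem q hzq)).eq_add_bdist_smul hD hz hzq
  have h2 := (G.normal q' hq' (hmem q' hzq')).eq_add_bdist_smul hD hz hzq'
  -- Two nearest points have the same height, so their difference is `δ` times a difference of
  -- normals; since `Lδ < 1`, the Lipschitz bound makes it vanish.
  have h3 : q - q' = bdist D z • (innerNormal D q' - innerNormal D q) := by
    rw [smul_sub, sub_eq_sub_iff_add_eq_add, ← h1, add_comm, ← h2]
  have hδ : 0 < bdist D z := bdist_pos hD hz hp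
  have hδρ : bdist D z < ρ := (bdist_le_dist hp).trans_lt hzρ
  have h4 : ‖q - q'‖ ≤ bdist D z * (L * ‖q - q'‖) := by
    conv_lhs => rw [h3]
    rw [norm_smul, Real.norm_of_nonneg hδ.le, norm_sub_rev]
    gcongr
    exact G.lipschitz q hq (hmem q hzq) q' hq' (hmem q' hzq')
  by_contra hne
  have h5 : 0 < ‖q - q'‖ := norm_pos_iff.2 (sub_ne_zero.2 (Ne.symm hne))
  have h6 : L * bdist D z ≤ L * ρ := by gcongr
  nlinarith

end NearestPoint

/-! ## Linear discs -/

section Discs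

variable {n : ℕ} {D : Set (EuclideanSpace ℂ (Fin n))} {p q c Y : EuclideanSpace ℂ (Fin n)}

theorem kobayashi_le_artanh_of_disc (hdisc : ∀ ζ ∈ ball (0 : ℂ) 1, c + ζ • Y ∈ D) {α : ℂ}
    (hα : ‖α‖ < 1) : kobayashi D c (c + α • Y) ≤ ENNReal.ofReal (Real.artanh ‖α‖) := by
  have hα' : α ∈ ball (0 : ℂ) 1 := by simpa using hα
  refine (kobayashi_le_lempert D (by simpa using hdisc 0 (by simp)) (hdisc α hα')).trans ?_
  refine iInf₂_le_of_le (fun ζ => c + ζ • Y) α (iInf_le_of_le ⟨?_, hdisc, hα', by simp, rfl⟩ le_rfl)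
  fun_prop

/-- After exponentiating and squaring, the claim is `1 + a ≤ (1 + 2a)²(1 - a)`, that is, `0 ≤ 2a(1 -
2a²)`. -/
theorem artanh_le_log_one_add {a : ℝ} (h0 : 0 ≤ a) (h1 : a ≤ 1 / 2) :
    Real.artanh a ≤ Real.log (1 + 2 * a) := by
  refine Real.log_le_log (Real.sqrt_pos.2 (div_pos (by linarith) (by linarith))) ?_
  refine Real.sqrt_le_iff.2 ⟨by linarith, (div_le_iff₀ (by linarith)).2 ?_⟩
  nlinarith [mul_nonneg h0 (sub_nonneg.2 h1), mul_nonneg (mul_nonneg h0 h0) (sub_nonneg.2 h1)]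

theorem artanh_one_sub_le {t : ℝ} (h0 : 0 < t) (h1 : t ≤ 1) :
    Real.artanh (1 - t) ≤ Real.log √(2 / t) := by
  refine Real.log_le_log (Real.sqrt_pos.2 (div_pos (by linarith) (by linarith)))
    (Real.sqrt_le_sqrt ?_)
  rw [sub_sub_cancel]
  gcongr
  linarith

/-- The disc of radius `H` centred at height `H` over the boundary point `q`, in the complex normal
direction, is contained in `D`. -/
theorem HasLipschitzNormals.normal_disc {L r H : ℝ} (G : HasLipschitzNormals D p L r)
    (hq : q ∈ frontier D) (hqr : q ∈ ball p (r / 2)) (hH : 0 < H) (hHr : 4 * H ≤ r)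
    (hL0 : 0 ≤ L) (hLH : 2 * (L * H) < 1) {ζ : ℂ} (hζ : ζ ∈ ball (0 : ℂ) 1) :
    (q + H • innerNormal D q) + ζ • H • innerNormal D q ∈ D := by
  have hqr' : q ∈ ball p r := ball_subset_ball (half_le_self G.radius_pos.le) hqr
  have hn := (G.normal q hq hqr').norm_eq_one
  rw [mem_ball_zero_iff] at hζ
  have hsub : (q + H • innerNormal D q) + ζ • H • innerNormal D q - q
      = ((H : ℂ) * (1 + ζ)) • innerNormal D q := by
    rw [← Complex.coe_smul, smul_smul, add_assoc, add_sub_cancel_left, ← add_smul]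
    ring_nf
  -- The disc touches the boundary at `ζ = -1`. This inequality shows that there the squared
  -- distance to `q` vanishes no slower than the height, so the paraboloid condition holds up to the
  -- tangency once `2LH < 1`.
  have hsq : ‖1 + ζ‖ ^ 2 < 2 * (1 + ζ.re) := by
    have h1 : ‖ζ‖ ^ 2 < 1 := by nlinarith [norm_nonneg ζ]
    rw [Complex.sq_norm, Complex.normSq_apply] at h1 ⊢
    simp only [Complex.add_re, Complex.add_im, Complex.one_re, Complex.one_im]
    nlinarith
  have hnorm : ‖((H : ℂ) * (1 + ζ)) • innerNormal D q‖ = H * ‖1 + ζ‖ := by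
    rw [norm_smul, hn, mul_one, norm_mul, Complex.norm_real, Real.norm_of_nonneg hH.le]
  have h2 : ‖1 + ζ‖ < 2 := by
    refine (norm_add_le _ _).trans_lt ?_
    rw [norm_one]
    linarith
  refine G.mem q hq hqr' _ ?_ ?_
  · rw [mem_ball, dist_eq_norm] at hqr ⊢
    calc _ ≤ ‖(q + H • innerNormal D q) + ζ • H • innerNormal D q - q‖ + ‖q - p‖ :=
          norm_sub_le_norm_sub_add_norm_sub _ _ _
      _ < r := by
          rw [hsub, hnorm]
          nlinarith
  · rw [hsub, hnorm, real_inner_eq_re_complex_inner, inner_smul_right,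
      inner_self_eq_norm_sq_to_K, hn]
    have hre : ((H : ℂ) * (1 + ζ) * ((1 : ℝ) : ℂ) ^ 2).re = H * (1 + ζ.re) := by simp
    refine lt_of_lt_of_eq ?_ hre.symm
    have h0 : 0 ≤ ‖1 + ζ‖ ^ 2 := by positivity
    have h3 : 0 < H * (1 + ζ.re) := mul_pos hH (by linarith)
    have h4 : L * (H * ‖1 + ζ‖) ^ 2 ≤ L * H * H * (2 * (1 + ζ.re)) := by
      rw [mul_pow, ← mul_assoc, sq H, ← mul_assoc]
      gcongr
    nlinarith

/-- A linear disc centred at height `h` over the boundary point `q` is contained in `D` if it is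
small compared with `h` in the complex normal direction and with `√(h / L)` in all directions. -/
theorem HasLipschitzNormals.disc {L r h : ℝ} (G : HasLipschitzNormals D p L r)
    (hq : q ∈ frontier D) (hqr : q ∈ ball p (r / 2)) (hh : 0 < h) (hYr : h + ‖Y‖ ≤ r / 2)
    (hL0 : 0 ≤ L) (hLh : 16 * (L * h) ≤ 1) (hYn : ‖inner ℂ (innerNormal D q) Y‖ ≤ h / 4)
    (hY : L * ‖Y‖ ^ 2 ≤ h / 8) {ζ : ℂ} (hζ : ζ ∈ ball (0 : ℂ) 1) :
    (q + h • innerNormal D q) + ζ • Y ∈ D := by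
  have hqr' : q ∈ ball p r := ball_subset_ball (half_le_self G.radius_pos.le) hqr
  have hn := (G.normal q hq hqr').norm_eq_one
  rw [mem_ball_zero_iff] at hζ
  have hsub : (q + h • innerNormal D q) + ζ • Y - q = h • innerNormal D q + ζ • Y := by
    rw [add_assoc, add_sub_cancel_left]
  have hnorm : ‖h • innerNormal D q + ζ • Y‖ ≤ h + ‖Y‖ := by
    refine (norm_add_le _ _).trans ?_
    rw [norm_smul, hn, mul_one, Real.norm_of_nonneg hh.le, norm_smul]
    gcongr
    exact mul_le_of_le_one_left (norm_nonneg _) hζ.le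
  refine G.mem q hq hqr' _ ?_ ?_
  · rw [mem_ball, dist_eq_norm] at hqr ⊢
    calc _ ≤ ‖(q + h • innerNormal D q) + ζ • Y - q‖ + ‖q - p‖ :=
          norm_sub_le_norm_sub_add_norm_sub _ _ _
      _ < r := by
          rw [hsub]
          linarith
  · rw [hsub, inner_add_right, real_inner_smul_right, real_inner_self_eq_norm_sq, hn,
      real_inner_eq_re_complex_inner _ (ζ • Y), inner_smul_right]
    have h1 : -(h / 4) ≤ (ζ * inner ℂ (innerNormal D q) Y).re := by
      refine (abs_le.1 ((Complex.abs_re_le_norm _).trans ?_)).1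
      rw [norm_mul]
      exact (mul_le_of_le_one_left (norm_nonneg _) hζ.le).trans hYn
    -- The height is at least `3h/4`, while `L` times this bound is at most `h/8 + h/4`.
    have h2 : ‖h • innerNormal D q + ζ • Y‖ ^ 2 ≤ 2 * h ^ 2 + 2 * ‖Y‖ ^ 2 := by
      refine (pow_le_pow_left₀ (norm_nonneg _) hnorm 2).trans ?_
      nlinarith [sq_nonneg (h - ‖Y‖)]
    have h3 : L * ‖h • innerNormal D q + ζ • Y‖ ^ 2 ≤ L * (2 * h ^ 2 + 2 * ‖Y‖ ^ 2) := by gcongr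
    nlinarith

/-- Climbing along the inner normal from height `δ` to height `H`. -/
theorem HasLipschitzNormals.kobayashi_normal_le {L r H δ : ℝ} (G : HasLipschitzNormals D p L r)
    (hq : q ∈ frontier D) (hqr : q ∈ ball p (r / 2)) (hδ : 0 < δ) (hδH : δ ≤ H) (hHr : 4 * H ≤ r)
    (hL0 : 0 ≤ L) (hLH : 2 * (L * H) < 1) :
    kobayashi D (q + H • innerNormal D q) (q + δ • innerNormal D q)
      ≤ ENNReal.ofReal (Real.log √(2 * H / δ)) := by
  have hH : 0 < H := hδ.trans_le hδH
  have ht : 0 < δ / H := div_pos hδ hH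
  have ht1 : δ / H ≤ 1 := (div_le_one hH).2 hδH
  have hn : ‖((δ / H - 1 : ℝ) : ℂ)‖ = 1 - δ / H := by
    rw [Complex.norm_real, Real.norm_of_nonpos (by linarith), neg_sub]
  -- In the tangent disc, the parameter `δ/H - 1` corresponds to height `δ`.
  have h := kobayashi_le_artanh_of_disc (α := ((δ / H - 1 : ℝ) : ℂ))
    (fun ζ hζ => G.normal_disc hq hqr hH hHr hL0 hLH hζ) (by rw [hn]; linarith)
  have heq : (q + H • innerNormal D q) + ((δ / H - 1 : ℝ) : ℂ) • H • innerNormal D q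
      = q + δ • innerNormal D q := by
    rw [Complex.coe_smul, smul_smul, add_assoc, ← add_smul]
    congr 2
    field_simp
    ring
  rw [heq, hn] at h
  refine h.trans (ENNReal.ofReal_le_ofReal ((artanh_one_sub_le ht ht1).trans_eq ?_))
  rw [div_div_eq_mul_div]

end Discs

/-! ## Comparison of two points near the boundary -/

section TwoPoints

variable {n : ℕ} {D : Set (EuclideanSpace ℂ (Fin n))} {p q q' : EuclideanSpace ℂ (Fin n)}
  {L r δ δ' : ℝ}

/-- The nearest point projection is Lipschitz. -/
theorem HasLipschitzNormals.norm_sub_le (G : HasLipschitzNormals D p L r)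
    (hq : q ∈ frontier D) (hqr : q ∈ ball p r) (hq' : q' ∈ frontier D) (hqr' : q' ∈ ball p r)
    (hδ : 0 ≤ δ) (hδ' : 0 ≤ δ') (hLδ : L * δ + L * δ' ≤ 1 / 2) :
    ‖q - q'‖ ≤ 2 * ‖(q + δ • innerNormal D q) - (q' + δ' • innerNormal D q')‖ := by
  set X := (q + δ • innerNormal D q) - (q' + δ' • innerNormal D q') with hX
  have hXe : X = (q - q') + δ • innerNormal D q - δ' • innerNormal D q' := by
    rw [hX]; abel
  have h1 := (abs_le.1 (G.abs_inner_le q hq hqr q' hq' hqr')).2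
  have h2 := (abs_le.1 (G.abs_inner_le q' hq' hqr' q hq hqr)).2
  rw [← neg_sub q q', inner_neg_right, norm_neg] at h1
  -- Pairing `X` with `q - q'`: by the paraboloid bounds the two normal terms take away at most `(Lδ
  -- + Lδ')|q - q'|²`, half of the main term.
  have h3 : inner ℝ X (q - q') = ‖q - q'‖ ^ 2 + δ * inner ℝ (innerNormal D q) (q - q')
      - δ' * inner ℝ (innerNormal D q') (q - q') := by
    rw [hXe, inner_sub_left, inner_add_left, real_inner_smul_left, real_inner_smul_left,
      real_inner_self_eq_norm_sq]
  have h4 := real_inner_le_norm X (q - q')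
  have h5 : ‖q - q'‖ ^ 2 ≤ 2 * (‖X‖ * ‖q - q'‖) := by
    nlinarith [mul_le_mul_of_nonneg_left h1 hδ, mul_le_mul_of_nonneg_left h2 hδ',
      mul_le_mul_of_nonneg_right hLδ (sq_nonneg ‖q - q'‖)]
  rcases (norm_nonneg (q - q')).eq_or_lt with h | h
  · rw [← h]; positivity
  · nlinarith

/-- The difference of the boundary distances is controlled by the normal component. -/
theorem HasLipschitzNormals.abs_sub_le (G : HasLipschitzNormals D p L r)
    (hq : q ∈ frontier D) (hqr : q ∈ ball p r) (hq' : q' ∈ frontier D) (hqr' : q' ∈ ball p r)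
    (hδ : 0 ≤ δ) (hδ' : 0 ≤ δ') (hL0 : 0 ≤ L) (hLδ : L * δ + L * δ' ≤ 1 / 2)
    {X : EuclideanSpace ℂ (Fin n)}
    (hX : X = (q + δ • innerNormal D q) - (q' + δ' • innerNormal D q')) :
    |δ - δ'| ≤ ‖inner ℂ (innerNormal D q) X‖ + 5 * (L * ‖X‖ ^ 2) := by
  have hd := G.norm_sub_le hq hqr hq' hqr' hδ hδ' hLδ
  rw [← hX] at hd
  have hd2 : ‖q - q'‖ ^ 2 ≤ 4 * ‖X‖ ^ 2 := by
    refine (pow_le_pow_left₀ (norm_nonneg _) hd 2).trans_eq ?_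
    ring
  have hn := (G.normal q hq hqr).norm_eq_one
  have hn' := (G.normal q' hq' hqr').norm_eq_one
  have h1 := G.abs_inner_le q hq hqr q' hq' hqr'
  rw [← neg_sub q q', inner_neg_right, norm_neg, abs_neg] at h1
  have h2 : ‖innerNormal D q - innerNormal D q'‖ ^ 2 ≤ L ^ 2 * (4 * ‖X‖ ^ 2) := by
    refine (pow_le_pow_left₀ (norm_nonneg _) (G.lipschitz q hq hqr q' hq' hqr') 2).trans ?_
    rw [mul_pow]
    gcongr
  rw [norm_sub_sq_real, hn, hn'] at h2
  have h3 : inner ℝ (innerNormal D q) (innerNormal D q') ≤ 1 := by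
    simpa [hn, hn'] using real_inner_le_norm (innerNormal D q) (innerNormal D q')
  -- The first term is at most `L|q - q'|² ≤ 4L|X|²`. The last is `δ'|n_q - n_{q'}|²/2`, quadratic
  -- in the change of normal, hence at most `L|X|²`; together they give the constant 5.
  have h4 : inner ℝ (innerNormal D q) X = inner ℝ (innerNormal D q) (q - q') + (δ - δ')
      + δ' * (1 - inner ℝ (innerNormal D q) (innerNormal D q')) := by
    have hXe : X = (q - q') + δ • innerNormal D q - δ' • innerNormal D q' := by
      rw [hX]; abel
    rw [hXe, inner_sub_right, inner_add_right, real_inner_smul_right, real_inner_smul_right,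
      real_inner_self_eq_norm_sq, hn]
    ring
  have h5 : |inner ℝ (innerNormal D q) X| ≤ ‖inner ℂ (innerNormal D q) X‖ := by
    rw [real_inner_eq_re_complex_inner]
    exact Complex.abs_re_le_norm _
  have h6 : δ' * (1 - inner ℝ (innerNormal D q) (innerNormal D q')) ≤ L * ‖X‖ ^ 2 := by
    have h7 : 0 ≤ L * ‖X‖ ^ 2 := by positivity
    have h8 : L * δ' ≤ 1 / 2 := by nlinarith [mul_nonneg hL0 hδ]
    calc _ ≤ δ' * (2 * L ^ 2 * ‖X‖ ^ 2) := by gcongr; linarith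
      _ = 2 * (L * δ') * (L * ‖X‖ ^ 2) := by ring
      _ ≤ _ := by nlinarith
  have h7 : 0 ≤ δ' * (1 - inner ℝ (innerNormal D q) (innerNormal D q')) :=
    mul_nonneg hδ' (by linarith)
  have h8 : L * ‖q - q'‖ ^ 2 ≤ L * (4 * ‖X‖ ^ 2) := by gcongr
  rw [abs_le] at h1 h5 ⊢
  constructor <;> linarith [h1.1, h1.2, h5.1, h5.2]

end TwoPoints

/-! ## The estimate -/

section Estimate

variable {n : ℕ} {D : Set (EuclideanSpace ℂ (Fin n))} {p q q' : EuclideanSpace ℂ (Fin n)}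
  {χ r δ δ' : ℝ}

/-- The estimate for two points which are close to each other: one linear disc suffices. -/
theorem HasLipschitzNormals.kobayashi_le_of_near (G : HasLipschitzNormals D p (2 * χ) r)
    (hq : q ∈ frontier D) (hqr : q ∈ ball p (r / 2)) (hχ : 0 < χ)
    (hδ : 0 < δ) (hδ' : 0 < δ') (hδδ' : δ' ≤ 2 * δ) (hχδ : 32 * (χ * δ) ≤ 1)
    (hδr : 4 * δ ≤ r) (hδχ : δ ≤ χ * r ^ 2) {X : EuclideanSpace ℂ (Fin n)} (hX0 : X ≠ 0)
    (hX : ‖inner ℂ (innerNormal D q) X‖ + χ * ‖X‖ ^ 2 ≤ δ / 100) :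
    kobayashi D (q + δ • innerNormal D q) (q + δ • innerNormal D q - X) ≤
      ENNReal.ofReal (Real.log (1 + 4000 * ((‖inner ℂ (innerNormal D q) X‖ + χ * ‖X‖ ^ 2
        + ‖X‖ * √(χ * δ)) / √(δ * δ')))) := by
  set N := ‖inner ℂ (innerNormal D q) X‖ with hN
  set d := ‖X‖ with hd
  set s := √(χ * δ) with hs
  have hs2 : s ^ 2 = χ * δ := Real.sq_sqrt (by positivity)
  have hs0 : 0 < s := Real.sqrt_pos.2 (by positivity)
  have hd0 : 0 < d := norm_pos_iff.2 hX0
  have hN0 : 0 ≤ N := norm_nonneg _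
  have hr := G.radius_pos
  have hds : d * s ≤ δ / 10 := by
    refine le_of_sq_le_sq ?_ (by positivity)
    rw [mul_pow, hs2]
    nlinarith
  -- The disc is `ζ ↦ z - ζX/a`, reaching `w` at `ζ = a`. The term `N` in `a` ensures the normal
  -- bound `N/a ≤ δ/4`; the term `d√(χδ)` ensures `2χ(d/a)² ≤ δ/8`.
  set a := 4 * (N + d * s) / δ with ha
  have ha0 : 0 < a := by positivity
  have haδ : a * δ = 4 * (N + d * s) := div_mul_cancel₀ _ hδ.ne'
  have ha1 : a ≤ 1 / 2 := by
    rw [ha, div_le_iff₀ hδ]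
    nlinarith [mul_nonneg hχ.le (sq_nonneg d)]
  have haY : ‖a⁻¹ • -X‖ = d / a := by
    rw [norm_smul, norm_neg, norm_inv, Real.norm_of_nonneg ha0.le, inv_mul_eq_div]
  have hYn : ‖inner ℂ (innerNormal D q) (a⁻¹ • -X)‖ ≤ δ / 4 := by
    rw [← Complex.coe_smul, inner_smul_right, inner_neg_right, norm_mul, norm_neg,
      Complex.norm_real, norm_inv, Real.norm_of_nonneg ha0.le, inv_mul_eq_div, div_le_iff₀ ha0,
      ← hN]
    nlinarith [mul_pos hd0 hs0]
  have hY2 : 16 * (χ * (d / a) ^ 2) ≤ δ := by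
    have h1 : 4 * (d * s) ≤ a * δ := by linarith
    have h2 := pow_le_pow_left₀ (by positivity) h1 2
    rw [mul_pow, mul_pow, hs2, mul_pow] at h2
    have h3 : 16 * (χ * d ^ 2) ≤ δ * a ^ 2 := by
      refine le_of_mul_le_mul_right ?_ hδ
      nlinarith
    rw [div_pow, ← mul_div_assoc, ← mul_div_assoc, div_le_iff₀ (by positivity)]
    exact h3
  -- Combines the preceding bound with `δ ≤ χr²`.
  have hYr : d / a ≤ r / 4 := by
    refine le_of_sq_le_sq ?_ (by positivity)
    refine le_of_mul_le_mul_left ?_ hχ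
    nlinarith
  have hna : ‖(a : ℂ)‖ = a := by rw [Complex.norm_real, Real.norm_of_nonneg ha0.le]
  have h := kobayashi_le_artanh_of_disc (α := (a : ℂ)) (fun ζ hζ =>
    G.disc hq hqr hδ (Y := a⁻¹ • -X) (by rw [haY]; linarith) (by positivity) (by linarith) hYn
      (by rw [haY]; linarith) hζ) (by rw [hna]; linarith)
  rw [hna, Complex.coe_smul, smul_smul, mul_inv_cancel₀ ha0.ne', one_smul, ← sub_eq_add_neg] at h
  refine h.trans (ENNReal.ofReal_le_ofReal ((artanh_le_log_one_add ha0.le ha1).trans ?_))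
  refine Real.log_le_log (by positivity) ?_
  have hsqrt : √(δ * δ') ≤ 2 * δ := Real.sqrt_le_iff.2 ⟨by positivity, by nlinarith⟩
  have hsqrt0 : 0 < √(δ * δ') := Real.sqrt_pos.2 (by positivity)
  have hA : a / 8 ≤ (N + χ * d ^ 2 + d * s) / √(δ * δ') := by
    rw [le_div_iff₀ hsqrt0]
    have h1 : a / 8 * √(δ * δ') ≤ a / 8 * (2 * δ) := by gcongr
    nlinarith [mul_nonneg hχ.le (sq_nonneg d)]
  linarith

/-- The estimate for two points which are far from each other, compared with their distances to the
boundary: climb along the normals, and connect the new points by a linear disc. -/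
theorem HasLipschitzNormals.kobayashi_le_of_far (G : HasLipschitzNormals D p (2 * χ) r)
    (hq : q ∈ frontier D) (hqr : q ∈ ball p (r / 2)) (hq' : q' ∈ frontier D)
    (hqr' : q' ∈ ball p (r / 2)) (hχ : 0 < χ) (hδ : 0 < δ) (hδ' : 0 < δ')
    (hz : q + δ • innerNormal D q ∈ D) (hw : q' + δ' • innerNormal D q' ∈ D)
    (hδr : 16 * (χ * δ) ≤ 1) (hδr' : 16 * (χ * δ') ≤ 1)
    {X : EuclideanSpace ℂ (Fin n)}
    (hX : X = (q + δ • innerNormal D q) - (q' + δ' • innerNormal D q'))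
    (hχX : 100000 * (χ * ‖X‖) ≤ 1) (hXr : 10000 * ‖X‖ ≤ r)
    (hfar : δ < 100 * (‖inner ℂ (innerNormal D q) X‖ + χ * ‖X‖ ^ 2)) :
    kobayashi D (q + δ • innerNormal D q) (q' + δ' • innerNormal D q') ≤
      ENNReal.ofReal (Real.log (1 + 4000 * ((‖inner ℂ (innerNormal D q) X‖ + χ * ‖X‖ ^ 2
        + ‖X‖ * √(χ * δ)) / √(δ * δ')))) := by
  have hsub : ball p (r / 2) ⊆ ball p r := ball_subset_ball (half_le_self G.radius_pos.le)
  have hn := (G.normal q hq (hsub hqr)).norm_eq_one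
  have hLδ : 2 * χ * δ + 2 * χ * δ' ≤ 1 / 2 := by linarith
  have hqq := G.norm_sub_le hq (hsub hqr) hq' (hsub hqr') hδ.le hδ'.le hLδ
  have hδδ := G.abs_sub_le hq (hsub hqr) hq' (hsub hqr') hδ.le hδ'.le (by positivity) hLδ hX
  rw [← hX] at hqq
  have hND : ‖inner ℂ (innerNormal D q) X‖ ≤ ‖X‖ := by
    simpa [hn] using norm_inner_le_norm (𝕜 := ℂ) (innerNormal D q) X
  set N := ‖inner ℂ (innerNormal D q) X‖ with hN
  set d := ‖X‖ with hd
  have hN0 : 0 ≤ N := norm_nonneg _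
  have hd0 : 0 ≤ d := norm_nonneg _
  have hr := G.radius_pos
  -- The factor 1000 puts `H` above both `δ` and `δ'` and leaves room for the crossing disc. With
  -- the 4 in `4H/√(δδ')` it produces the final constant 4000.
  set H := 1000 * (N + χ * d ^ 2) with hH
  have hχd : χ * d ^ 2 ≤ d / 10000 := by nlinarith
  have hχd0 : 0 ≤ χ * d ^ 2 := by positivity
  have hH0 : 0 < H := by linarith
  have hHd : H ≤ 1001 * d := by linarith
  have hδH : δ ≤ H := by linarith
  have hδH' : δ' ≤ H := by linarith [(abs_le.1 hδδ).1]
  have hHr : 4 * H ≤ r := by linarith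
  have hχH : χ * H ≤ 1001 * (χ * d) := by nlinarith
  have hχH' : 2 * (2 * χ * H) < 1 := by linarith
  have hnn : ‖innerNormal D q' - innerNormal D q‖ ≤ 4 * (χ * d) := by
    rw [norm_sub_rev]
    refine (G.lipschitz q hq (hsub hqr) q' hq' (hsub hqr')).trans ?_
    nlinarith
  have hχd4 : H * (4 * (χ * d)) ≤ H * (4 / 100000) := by gcongr; linarith
  -- The points at height `H`.
  set z₁ := q + H • innerNormal D q with hz₁
  set w₁ := q' + H • innerNormal D q' with hw₁
  have hz₁D : z₁ ∈ D := by
    simpa using G.normal_disc hq hqr hH0 hHr (by positivity) hχH' (mem_ball_self one_pos)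
  have hw₁D : w₁ ∈ D := by
    simpa using G.normal_disc hq' hqr' hH0 hHr (by positivity) hχH' (mem_ball_self one_pos)
  have hzz : kobayashi D (q + δ • innerNormal D q) z₁ ≤ ENNReal.ofReal (Real.log √(2 * H / δ)) := by
    rw [(kobayashi_isPseudodistOn D).symm _ hz _ hz₁D]
    exact G.kobayashi_normal_le hq hqr hδ hδH hHr (by positivity) hχH'
  have hww : kobayashi D w₁ (q' + δ' • innerNormal D q') ≤
      ENNReal.ofReal (Real.log √(2 * H / δ')) :=
    G.kobayashi_normal_le hq' hqr' hδ' hδH' hHr (by positivity) hχH'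
  have hzw_norm : ‖w₁ - z₁‖ ≤ 3 * d := by
    have h1 : w₁ - z₁ = -(q - q') + H • (innerNormal D q' - innerNormal D q) := by
      rw [hw₁, hz₁, smul_sub]; abel
    rw [h1]
    refine (norm_add_le _ _).trans ?_
    rw [norm_neg, norm_smul, Real.norm_of_nonneg hH0.le]
    have h2 : H * ‖innerNormal D q' - innerNormal D q‖ ≤ H * (4 * (χ * d)) := by gcongr
    linarith
  have hzw_inner : ‖inner ℂ (innerNormal D q) (w₁ - z₁)‖ ≤ H / 8 := by
    -- The normal components of the three terms are bounded by `N`, by `abs_sub_le`, and by the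
    -- Lipschitz bound on the normals.
    have h1 : w₁ - z₁ = -X + (δ - δ') • innerNormal D q
        + (H - δ') • (innerNormal D q' - innerNormal D q) := by
      rw [hw₁, hz₁, hX, smul_sub, sub_smul, sub_smul, sub_smul]; abel
    have h2 : ‖inner ℂ (innerNormal D q) ((δ - δ') • innerNormal D q)‖ ≤ |δ - δ'| := by
      refine (norm_inner_le_norm _ _).trans ?_
      rw [norm_smul, hn, one_mul, mul_one, Real.norm_eq_abs]
    have h3 : ‖inner ℂ (innerNormal D q) ((H - δ') • (innerNormal D q' - innerNormal D q))‖
        ≤ H * (4 * (χ * d)) := by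
      refine (norm_inner_le_norm _ _).trans ?_
      rw [norm_smul, hn, one_mul, Real.norm_of_nonneg (sub_nonneg.2 hδH')]
      gcongr
      linarith
    rw [h1, inner_add_right, inner_add_right, inner_neg_right]
    refine (norm_add_le _ _).trans ?_
    have h4 := norm_add_le (-inner ℂ (innerNormal D q) X)
      (inner ℂ (innerNormal D q) ((δ - δ') • innerNormal D q))
    rw [norm_neg, ← hN] at h4
    linarith
  have hzw : kobayashi D z₁ w₁ ≤ ENNReal.ofReal (Real.log 2) := by
    -- The crossing disc has radius vector `2(w₁ - z₁)`, so `w₁` sits at parameter `1/2`, and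
    -- `artanh (1/2) ≤ log 2`.
    have hY : ‖(2 : ℂ) • (w₁ - z₁)‖ = 2 * ‖w₁ - z₁‖ := by simp [norm_smul]
    have hα : ‖(2⁻¹ : ℂ)‖ = 1 / 2 := by norm_num
    have hYsq : χ * ‖w₁ - z₁‖ ^ 2 ≤ χ * (3 * d) ^ 2 := by gcongr
    have h := kobayashi_le_artanh_of_disc (α := 2⁻¹) (fun ζ hζ =>
      G.disc hq hqr hH0 (Y := (2 : ℂ) • (w₁ - z₁)) (by rw [hY]; linarith) (by positivity)
        (by linarith) (by rw [inner_smul_right, norm_mul, Complex.norm_ofNat]; linarith)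
        (by rw [hY]; nlinarith) hζ) (by rw [hα]; norm_num)
    rw [smul_smul, inv_mul_cancel₀ two_ne_zero, one_smul, ← hz₁, add_sub_cancel, hα] at h
    refine h.trans (ENNReal.ofReal_le_ofReal
      ((artanh_le_log_one_add (by norm_num) le_rfl).trans_eq ?_))
    norm_num
  have hlog : ∀ {t : ℝ}, 0 < t → t ≤ H → 0 ≤ Real.log √(2 * H / t) := fun ht htH =>
    Real.log_nonneg (Real.one_le_sqrt.2 ((one_le_div ht).2 (by linarith)))
  have hK := kobayashi_isPseudodistOn D
  refine (hK.triangle _ hz _ hz₁D _ hw).trans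
    ((add_le_add hzz ((hK.triangle _ hz₁D _ hw₁D _ hw).trans (add_le_add hzw hww))).trans ?_)
  rw [← ENNReal.ofReal_add (Real.log_nonneg one_le_two) (hlog hδ' hδH'),
    ← ENNReal.ofReal_add (hlog hδ hδH) (add_nonneg (Real.log_nonneg one_le_two) (hlog hδ' hδH'))]
  have hs : 0 < √(2 * H / δ) := Real.sqrt_pos.2 (by positivity)
  have hs' : 0 < √(2 * H / δ') := Real.sqrt_pos.2 (by positivity)
  rw [← Real.log_mul two_ne_zero hs'.ne', ← Real.log_mul hs.ne' (by positivity)]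
  refine ENNReal.ofReal_le_ofReal (Real.log_le_log (by positivity) ?_)
  have hprod : √(2 * H / δ) * (2 * √(2 * H / δ')) = 4 * H / √(δ * δ') := by
    rw [Real.sqrt_div (by positivity), Real.sqrt_div (by positivity), Real.sqrt_mul hδ.le]
    have h1 : √(2 * H) * √(2 * H) = 2 * H := Real.mul_self_sqrt (by positivity)
    have h2 : √δ ≠ 0 := (Real.sqrt_pos.2 hδ).ne'
    have h3 : √δ' ≠ 0 := (Real.sqrt_pos.2 hδ').ne'
    field_simp
    linarith
  have hle : 4 * H / √(δ * δ') ≤ 4000 * ((N + χ * d ^ 2 + d * √(χ * δ)) / √(δ * δ')) := by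
    rw [← mul_div_assoc]
    refine div_le_div_of_nonneg_right ?_ (Real.sqrt_nonneg _)
    have : 0 ≤ d * √(χ * δ) := by positivity
    linarith
  linarith

end Estimate

/-- The first two clauses of the conclusion only say that the quantities in the estimate are
well defined: `χ_{D,p} < ∞`, and `π(z)` and the normal `n_{π(z)}` exist for `z ∈ D ∩ U`. -/
theorem theorem2 :
    ∃ C₀ : ℝ, 0 < C₀ ∧
      ∀ (n : ℕ) (D : Set (EuclideanSpace ℂ (Fin n))) (p : EuclideanSpace ℂ (Fin n)),
        IsOpen D → IsConnected D → IsC11BoundaryPoint D p → 0 < curvatureConst D p →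
          curvatureConst D p < ⊤ ∧
          ∃ U ∈ 𝓝 p,
            (∀ z ∈ D ∩ U, ∃ q ν, IsProj D z q ∧ IsInnerUnitNormal D q ν) ∧
            ∀ z ∈ D ∩ U, ∀ w ∈ D ∩ U,
              kobayashi D z w ≤ ENNReal.ofReal (Real.log (1 + C₀ * AQuantity D p z w)) := by
  refine ⟨4000, by norm_num, fun n D p hD _ hp hχ₀ => ?_⟩
  have htop := hp.curvatureConst_lt_top
  refine ⟨htop, ?_⟩
  set χ := (curvatureConst D p).toReal with hχ_def
  have hχ : 0 < χ := ENNReal.toReal_pos hχ₀.ne' htop.ne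
  -- Positivity of `χ` enters here: `2χ` strictly exceeds `χ`.
  obtain ⟨r, G⟩ := hp.exists_hasLipschitzNormals (L := 2 * χ) (by positivity) (by
    rw [← ENNReal.ofReal_toReal htop.ne, ← hχ_def, ENNReal.ofReal_lt_ofReal_iff']
    constructor <;> linarith)
  have hr := G.radius_pos
  have hpD := hp.1
  -- Since `|z - w| < 2ρ`, the first two bounds are the smallness conditions of the far case; `ρ ≤
  -- χr²` keeps the disc of the near case inside the ball where the geometry is known.
  obtain ⟨ρ, hρ, hρr, hρχ, hρχr⟩ : ∃ ρ : ℝ, 0 < ρ ∧ 20000 * ρ ≤ r ∧ 200000 * (χ * ρ) ≤ 1 ∧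
      ρ ≤ χ * r ^ 2 := by
    refine ⟨min (r / 20000) (min (1 / (200000 * χ)) (χ * r ^ 2)), by positivity, ?_, ?_, ?_⟩
    · linarith [min_le_left (r / 20000) (min (1 / (200000 * χ)) (χ * r ^ 2))]
    · have h := (min_le_right (r / 20000) _).trans (min_le_left (1 / (200000 * χ)) (χ * r ^ 2))
      rw [le_div_iff₀ (by positivity)] at h
      linarith
    · exact (min_le_right _ _).trans (min_le_right _ _)
  have hsub : ball p (r / 2) ⊆ ball p r := ball_subset_ball (half_le_self hr.le)
  have hsub' : ball p (2 * ρ) ⊆ ball p (r / 2) := ball_subset_ball (by linarith)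
  have hproj : ∀ z ∈ D ∩ ball p ρ, ∃ q ∈ frontier D, q ∈ ball p (r / 2) ∧ IsProj D z q ∧
      z = q + bdist D z • innerNormal D q := by
    rintro z ⟨hz, hzρ⟩
    obtain ⟨q, hq, hzq⟩ := exists_dist_eq_bdist hpD z
    have hqr := hsub' (dist_lt_of_dist_eq_bdist hpD hzρ hzq)
    exact ⟨q, hq, hqr, G.isProj hD hpD (by linarith) (by positivity) (by linarith) hz hzρ hq hzq,
      (G.normal q hq (hsub hqr)).eq_add_bdist_smul hD hz hzq⟩
  refine ⟨ball p ρ, ball_mem_nhds p hρ, fun z hz => ?_, fun z hz w hw => ?_⟩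
  · obtain ⟨q, hq, hqr, hzq, -⟩ := hproj z hz
    exact ⟨q, innerNormal D q, hzq, G.normal q hq (hsub hqr)⟩
  obtain ⟨q, hq, hqr, hzq, hz_eq⟩ := hproj z hz
  obtain ⟨q', hq', hqr', -, hw_eq⟩ := hproj w hw
  rw [AQuantity, normalComp, hzq.bproj_eq, ← hχ_def]
  have hδ : 0 < bdist D z := bdist_pos hD hz.1 hpD
  have hδ' : 0 < bdist D w := bdist_pos hD hw.1 hpD
  have hδρ : bdist D z < ρ := (bdist_le_dist hpD).trans_lt hz.2
  have hδρ' : bdist D w < ρ := (bdist_le_dist hpD).trans_lt hw.2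
  have hd : ‖z - w‖ < 2 * ρ := by
    have h1 := mem_ball.1 hz.2
    have h2 := mem_ball.1 hw.2
    rw [← dist_eq_norm]
    linarith [dist_triangle_right z w p]
  have hχδ : χ * bdist D z ≤ χ * ρ := by gcongr
  have hχδ' : χ * bdist D w ≤ χ * ρ := by gcongr
  have hχd : χ * ‖z - w‖ ≤ χ * (2 * ρ) := by gcongr
  have hzD := hz.1
  have hwD := hw.1
  set δ := bdist D z
  set δ' := bdist D w
  have hX : z - w = (q + δ • innerNormal D q) - (q' + δ' • innerNormal D q') := by
    rw [← hz_eq, ← hw_eq]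
  -- For `z = w` the near case would have parameter `a = 0`, by which its disc is divided.
  rcases eq_or_ne z w with rfl | hne
  · rw [(kobayashi_isPseudodistOn D).self z hzD]
    exact zero_le
  rcases le_or_gt (‖inner ℂ (innerNormal D q) (z - w)‖ + χ * ‖z - w‖ ^ 2) (δ / 100) with h | h
  · have hδδ := G.abs_sub_le hq (hsub hqr) hq' (hsub hqr') hδ.le hδ'.le (by positivity)
      (by linarith) hX
    have hN := norm_nonneg (inner ℂ (innerNormal D q) (z - w))
    have key := G.kobayashi_le_of_near hq hqr hχ hδ hδ' (by linarith [(abs_le.1 hδδ).1])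
      (by linarith) (by linarith) (by linarith) (sub_ne_zero.2 hne) h
    rwa [← hz_eq, sub_sub_cancel] at key
  · have key := G.kobayashi_le_of_far hq hqr hq' hqr' hχ hδ hδ' (hz_eq ▸ hzD) (hw_eq ▸ hwD)
      (by linarith) (by linarith) hX (by linarith) (by linarith) (by linarith)
    rwa [← hz_eq, ← hw_eq] at key
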